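/- \textbf{Setting.} Let $\mathcal L$ be a lattice: an infinite graph drawn in a finite-dimensional Euclidean space, with directed or undirected edges, such that (I) there are finitely many equivalence classes $\mathcal V_1,\dots,\mathcal V_K$ of vertices under the translations of $\mathcal L$ (the vectors by which translation maps the drawn graph onto itself), (II) every vertex has finite (out-)degree, and (III) any two vertices are connected by a walk. Let $\mathcal E_1,\dots,\mathcal E_d$ be the (finitely many) equivalence classes of edges under translations. An $n$-step walk is a sequence $(v_0,e_1,v_1,\dots,e_n,v_n)$ in which $e_i$ leads from $v_{i-1}$ to $v_i$; it is a self-avoiding walk (SAW) if its vertices are distinct, and a self-avoiding trail (SAT) if its edges are distinct. A single vertex is a $0$-step walk. Fix one of the two kinds, SAW or SAT; below, ``SAW'' means a walk of this kind. For $\mathbf z\in\mathbb R_{>0}^d$ the weight of a walk $\gamma$ is $\mathbf w(\gamma)=\prod_{i=1}^d \mathbf z_i^{N_i(\gamma)}$, where $N_i(\gamma)$ is the number of edges of $\gamma$ in $\mathcal E_i$. A symmetry of $\mathcal L$ (a graph automorphism, acting on vertices and edges) is weight-preserving with respect to $\mathbf z$ if every edge has the same weight as its image. Let $0\le m<n$,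 and fix a representative $v_k\in\mathcal V_k$ for each $k$. Let $\mathcal P=\{\mathcal P_1,\dots,\mathcal P_t\}$ be a partition of the set of all $m$-step SAWs starting from one of $v_1,\dots,v_K$, and fix $\gamma_r\in\mathcal P_r$ for each $r$. We call $\mathcal P$ compatible with $\mathbf z\in\mathbb R_{>0}^d$ if any two walks in the same part are related by a symmetry of $\mathcal L$ that is weight-preserving with respect to $\mathbf z$. Let $\mathbf G^{\mathcal P}_{\mathbf z}(m,n)$ be the $t\times t$ matrix with entries $\mathbf F_{rs}/\mathbf w(\gamma_r)$, where $\mathbf F_{rs}$ is the sum of the weights of all $n$-step SAWs whose first $m$ steps form $\gamma_r$ and whose last $m$ steps form a translation of some walk in $\mathcal P_s$. A square matrix is primitive if it is nonnegative and some positive power of it is entrywise positive; then $\lambda_1$ denotes its dominant eigenvalue, i.e. the real eigenvalue that strictly exceeds the absolute values of all other complex eigenvalues. Put $$\mathcal D^{\mathcal P}(m,n):=\bigcup_{\mathbf z}\ \prod_{i=1}^d[-\mathbf z_i,\mathbf z_i]\subseteq\mathbb R^d,$$ where the union is over all $\mathbf z\in\mathbb R_{>0}^d$ such that $\mathcal P$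 is compatible with $\mathbf z$, $\mathbf G^{\mathcal P}_{\mathbf z}(m,n)$ is primitive, and $\lambda_1(\mathbf G^{\mathcal P}_{\mathbf z}(m,n))<1$. For $1\le k\le K$ and $\mathbf n\in\mathbb Z_{\ge0}^d$ let $c_{\mathbf n,k}$ be the number of SAWs that start from a fixed vertex in $\mathcal V_k$ and contain exactly $\mathbf n_i$ edges of $\mathcal E_i$ for each $i$, and let $g_k(\mathbf x)=\sum_{\mathbf n\in\mathbb Z_{\ge0}^d}c_{\mathbf n,k}\,\mathbf x^{\mathbf n}$, with $\mathbf x^{\mathbf n}=\prod_i\mathbf x_i^{\mathbf n_i}$, be the anisotropic generating function. \textbf{Statement.} The set $\mathcal D^{\mathcal P}(m,n)$ is open in $\mathbb R^d$, and for every $1\le k\le K$ the series $g_k(\mathbf x)$ converges absolutely at every $\mathbf x\in\mathcal D^{\mathcal P}(m,n)$. Moreover, $g_k$ is (real-)analytic on $\mathcal D^{\mathcal P}(m,n)$. -/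

import Mathlib

namespace SAW

/-- The points of `D`-dimensional Euclidean space. -/
abbrev Pt (D : ℕ) : Type := EuclideanSpace ℝ (Fin D)

/-- An edge drawn in Euclidean space: the set of points of its drawing, and the set of ordered
pairs `(u, v)` such that the edge may be traversed from `u` to `v` (one pair for a directed edge,
a pair and its reverse for an undirected one). -/
@[ext]
structure DrawnEdge (D : ℕ) where
  carrier : Set (Pt D)
  dir : Set (Pt D × Pt D)

namespace DrawnEdge

/-- The translate of a drawn edge by the vector `a`. -/
def translate {D : ℕ} (a : Pt D) (e : DrawnEdge D) : DrawnEdge D where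
  carrier := (fun p => a + p) '' e.carrier
  dir := (fun q => (a + q.1, a + q.2)) '' e.dir

theorem translate_zero {D : ℕ} (e : DrawnEdge D) : translate 0 e = e := by
  ext <;> simp [translate]

theorem translate_add {D : ℕ} (a b : Pt D) (e : DrawnEdge D) :
    translate (a + b) e = translate a (translate b e) := by
  cases e
  simp only [translate, Set.image_image, add_assoc]

end DrawnEdge

/-- A graph drawn in `D`-dimensional Euclidean space. Every edge is directed or undirected, has its
endpoints among the vertices, and is drawn as a curve that joins its endpoints. Parallel edges are
allowed; they are told apart by their drawings. -/
structure DrawnGraph (D : ℕ) where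
  verts : Set (Pt D)
  edges : Set (DrawnEdge D)
  drawn : ∀ e ∈ edges, ∃ u ∈ verts, ∃ v ∈ verts,
    (e.dir = {(u, v)} ∨ e.dir = {(u, v), (v, u)}) ∧
      ∃ c : Path u v, Set.range c = e.carrier

namespace DrawnGraph

variable {D : ℕ} (L : DrawnGraph D)

/-- The type of vertices. -/
abbrev Vertex : Type := L.verts

/-- The type of edges. -/
abbrev Edge : Type := L.edges

/-- The edge `e` can be traversed from `u` to `v`. -/
def Joins (e : L.Edge) (u v : L.Vertex) : Prop :=
  ((u : Pt D), (v : Pt D)) ∈ (e : DrawnEdge D).dir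

/-! ### Translations and equivalence classes -/

/-- The translations of the graph: the vectors `a` such that the translation by `a` maps the set of
vertices onto itself and the set of drawn edges onto itself. -/
def translations : AddSubgroup (Pt D) where
  carrier := {a | (fun p => a + p) '' L.verts = L.verts ∧
    DrawnEdge.translate a '' L.edges = L.edges}
  zero_mem' := by
    constructor
    · simp
    · simp [DrawnEdge.translate_zero]
  add_mem' := by
    rintro a b ⟨ha, ha'⟩ ⟨hb, hb'⟩
    constructor
    · conv_rhs => rw [← ha, ← hb, Set.image_image]
      simp only [add_assoc]
    · conv_rhs => rw [← ha', ← hb', Set.image_image]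
      simp only [DrawnEdge.translate_add]
  neg_mem' := by
    rintro a ⟨ha, ha'⟩
    constructor
    · conv_lhs => rw [← ha, Set.image_image]
      simp
    · conv_lhs => rw [← ha', Set.image_image]
      simp only [← DrawnEdge.translate_add, neg_add_cancel, DrawnEdge.translate_zero,
        Set.image_id']

/-- Two vertices are equivalent if they are related by a translation of the graph. -/
def vertexSetoid : Setoid L.Vertex where
  r u v := ∃ a ∈ L.translations, (v : Pt D) = a + u
  iseqv :=
    { refl := fun u => ⟨0, zero_mem _, by simp⟩
      symm := by
        rintro u v ⟨a, ha, h⟩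
        exact ⟨-a, neg_mem ha, by simp [h]⟩
      trans := by
        rintro u v w ⟨a, ha, h⟩ ⟨b, hb, h'⟩
        exact ⟨b + a, add_mem hb ha, by rw [h', h, add_assoc]⟩ }

/-- Two edges are equivalent if they are related by a translation of the graph. -/
def edgeSetoid : Setoid L.Edge where
  r e f := ∃ a ∈ L.translations, (f : DrawnEdge D) = DrawnEdge.translate a e
  iseqv :=
    { refl := fun e => ⟨0, zero_mem _, by simp [DrawnEdge.translate_zero]⟩
      symm := by
        rintro e f ⟨a, ha, h⟩
        refine ⟨-a, neg_mem ha, ?_⟩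
        rw [h, ← DrawnEdge.translate_add, neg_add_cancel, DrawnEdge.translate_zero]
      trans := by
        rintro e f g ⟨a, ha, h⟩ ⟨b, hb, h'⟩
        exact ⟨b + a, add_mem hb ha, by rw [h', h, DrawnEdge.translate_add]⟩ }

/-- The vertex classes `𝒱₁, …, 𝒱_K`. -/
def VertexClass : Type := Quotient L.vertexSetoid

/-- The edge classes `ℰ₁, …, ℰ_d`. -/
def EdgeClass : Type := Quotient L.edgeSetoid

/-- The class of a vertex. -/
def vertexClass (v : L.Vertex) : L.VertexClass := Quotient.mk L.vertexSetoid v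

/-- The class of an edge. -/
def edgeClass (e : L.Edge) : L.EdgeClass := Quotient.mk L.edgeSetoid e

/-! ### Walks -/

/-- An `n`-step walk `(v₀, e₁, v₁, …, eₙ, vₙ)`; a `0`-step walk is a single vertex. -/
structure Walk (n : ℕ) where
  vert : Fin (n + 1) → L.Vertex
  edge : Fin n → L.Edge
  joins : ∀ i : Fin n, L.Joins (edge i) (vert i.castSucc) (vert i.succ)

/-- The two kinds of self-avoidance: walks with distinct vertices (SAW) and trails, with distinct
edges (SAT). -/
inductive Kind where
  | saw
  | sat

namespace Walk

variable {L}

/-- The starting point of a walk. -/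
def start {n : ℕ} (W : L.Walk n) : L.Vertex := W.vert 0

/-- The final point of a walk. -/
def finish {n : ℕ} (W : L.Walk n) : L.Vertex := W.vert (Fin.last n)

/-- The walk is a SAW, respectively a SAT. -/
def IsAvoiding {n : ℕ} (κ : Kind) (W : L.Walk n) : Prop :=
  match κ with
  | Kind.saw => Function.Injective W.vert
  | Kind.sat => Function.Injective W.edge

/-- The `m`-step piece of a walk that begins after `i` steps. -/
def segment {n : ℕ} (W : L.Walk n) (i m : ℕ) (h : i + m ≤ n) : L.Walk m where
  vert j := W.vert ⟨i + j, by omega⟩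
  edge j := W.edge ⟨i + j, by omega⟩
  joins j := W.joins ⟨i + j, by omega⟩

/-- `W'` is a translation of `W`. -/
def IsTranslate {n : ℕ} (W W' : L.Walk n) : Prop :=
  ∃ a ∈ L.translations, (∀ i, (W'.vert i : Pt D) = a + W.vert i) ∧
    ∀ i, (W'.edge i : DrawnEdge D) = DrawnEdge.translate a (W.edge i)

/-- `N_i(γ)`, the number of edges of the walk `γ` that belong to the edge class `i`. -/
noncomputable def count {n : ℕ} (W : L.Walk n) (i : L.EdgeClass) : ℕ :=
  Nat.card {j : Fin n // L.edgeClass (W.edge j) = i}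

end Walk

/-! ### Lattices -/

/-- The standing assumptions on a lattice: it is infinite, has finitely many vertex classes under
its translations and finite (out-)degrees, and is strongly connected. -/
class IsLattice : Prop where
  infinite : L.verts.Infinite
  finite_vertexClass : Finite L.VertexClass
  finite_degree : ∀ u : L.Vertex, {e : L.Edge | ∃ v, L.Joins e u v}.Finite
  strongly_connected : ∀ u v : L.Vertex, ∃ (n : ℕ) (W : L.Walk n), W.start = u ∧ W.finish = v

instance instFiniteEdgeClass [L.IsLattice] : Finite L.EdgeClass := by
  have h1 : Finite L.VertexClass := IsLattice.finite_vertexClass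
  let rep : L.VertexClass → L.Vertex := fun k => Quotient.out k
  have h2 : ∀ k, Finite {e : L.Edge | ∃ v, L.Joins e (rep k) v} := fun k =>
    (IsLattice.finite_degree (rep k)).to_subtype
  let f : (Σ k : L.VertexClass, {e : L.Edge | ∃ v, L.Joins e (rep k) v}) → L.EdgeClass :=
    fun p => L.edgeClass p.2.1
  refine Finite.of_surjective f ?_
  intro c
  obtain ⟨e, rfl⟩ := Quotient.exists_rep c
  obtain ⟨u, hu, v, hv, hd, -⟩ := L.drawn e.1 e.2
  have huv : (u, v) ∈ e.1.dir := by
    rcases hd with hd | hd <;> rw [hd] <;> simp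
  have hrel : L.vertexSetoid.r ⟨u, hu⟩ (rep (L.vertexClass ⟨u, hu⟩)) :=
    L.vertexSetoid.symm' (Quotient.exact (Quotient.out_eq (L.vertexClass ⟨u, hu⟩)))
  obtain ⟨a, ha, hrep⟩ := hrel
  have hv' : a + v ∈ L.verts :=
    ha.1.subset ⟨v, hv, rfl⟩
  have he' : DrawnEdge.translate a e.1 ∈ L.edges :=
    ha.2.subset ⟨e.1, e.2, rfl⟩
  refine ⟨⟨L.vertexClass ⟨u, hu⟩, ⟨⟨_, he'⟩, ⟨a + v, hv'⟩, ?_⟩⟩, ?_⟩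
  · change ((rep (L.vertexClass ⟨u, hu⟩) : Pt D), a + v) ∈ _
    rw [hrep]
    exact ⟨(u, v), huv, rfl⟩
  · exact Quotient.sound (L.edgeSetoid.symm' ⟨a, ha, rfl⟩)

noncomputable instance instFintypeEdgeClass [L.IsLattice] : Fintype L.EdgeClass :=
  Fintype.ofFinite L.EdgeClass

/-! ### Symmetries -/

/-- A symmetry of the graph: a bijection of the vertices together with a bijection of the edges
that respects incidence. -/
structure Symm where
  onVert : L.Vertex ≃ L.Vertex
  onEdge : L.Edge ≃ L.Edge
  joins_iff : ∀ e u v, L.Joins (onEdge e) (onVert u) (onVert v) ↔ L.Joins e u v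

variable {L}

/-- The symmetry preserves the weights of all edges, where `z i` is the weight of every edge of the
class `i`. -/
def Symm.IsWeightPreserving (τ : L.Symm) (z : L.EdgeClass → ℝ) : Prop :=
  ∀ e, z (L.edgeClass e) = z (L.edgeClass (τ.onEdge e))

/-- The symmetry maps the walk `W` to the walk `W'`. -/
def Symm.MapsTo (τ : L.Symm) {n : ℕ} (W W' : L.Walk n) : Prop :=
  (∀ i, W'.vert i = τ.onVert (W.vert i)) ∧ ∀ i, W'.edge i = τ.onEdge (W.edge i)

/-! ### Weights, partitions and matrices -/

/-- The weight `𝐰(γ) = ∏ᵢ zᵢ ^ N_i(γ)` of a walk. -/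
noncomputable def weight [L.IsLattice] (z : L.EdgeClass → ℝ) {n : ℕ} (W : L.Walk n) : ℝ :=
  ∏ i, z i ^ W.count i

/-- `P` is a partition, into the nonempty parts `P s`, of the set of all `m`-step SAWs (SATs) that
start from one of the representatives `v k` of the vertex classes. -/
structure IsPartition (κ : Kind) (v : L.VertexClass → L.Vertex) {m t : ℕ}
    (P : Fin t → Set (L.Walk m)) : Prop where
  nonempty : ∀ s, (P s).Nonempty
  disjoint : Pairwise fun r s => Disjoint (P r) (P s)
  iUnion_eq : ⋃ s, P s = {W | W.IsAvoiding κ ∧ ∃ k, W.start = v k}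

/-- Any two walks in the same part of `P` are related by a symmetry that is weight-preserving with
respect to `z`. -/
def IsCompatible (z : L.EdgeClass → ℝ) {m t : ℕ} (P : Fin t → Set (L.Walk m)) : Prop :=
  ∀ s, ∀ W ∈ P s, ∀ W' ∈ P s, ∃ τ : L.Symm, τ.IsWeightPreserving z ∧ τ.MapsTo W W'

/-- `𝐅_rs(m,n)`: the sum of the weights of all `n`-step SAWs (SATs) that start with the fixed
`m`-step walk `γ r` and end with a translation of any walk in `P s`. -/
noncomputable def matF [L.IsLattice] (κ : Kind) (z : L.EdgeClass → ℝ) {m n t : ℕ} (hmn : m < n)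
    (P : Fin t → Set (L.Walk m)) (γ : Fin t → L.Walk m) (r s : Fin t) : ℝ :=
  ∑ᶠ W ∈ {W : L.Walk n | W.IsAvoiding κ ∧ W.segment 0 m (by omega) = γ r ∧
    ∃ δ ∈ P s, δ.IsTranslate (W.segment (n - m) m (by omega))}, weight z W

/-- The matrix `𝐆(m,n)` with entries `𝐅_rs(m,n) / 𝐰(γ_r)`. -/
noncomputable def matG [L.IsLattice] (κ : Kind) (z : L.EdgeClass → ℝ) {m n t : ℕ} (hmn : m < n)
    (P : Fin t → Set (L.Walk m)) (γ : Fin t → L.Walk m) : Matrix (Fin t) (Fin t) ℝ :=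
  Matrix.of fun r s => matF κ z hmn P γ r s / weight z (γ r)

/-- `l` is the dominant eigenvalue of the real matrix `A`: it is an eigenvalue, and every other
complex eigenvalue has absolute value strictly less than `l`. -/
def IsDominantEigenvalue {t : ℕ} (A : Matrix (Fin t) (Fin t) ℝ) (l : ℝ) : Prop :=
  Module.End.HasEigenvalue (Matrix.toLin' A) l ∧
    ∀ μ : ℂ, Module.End.HasEigenvalue (Matrix.toLin' (A.map (fun a : ℝ => (a : ℂ)))) μ →
      μ ≠ (l : ℂ) → ‖μ‖ < l

/-- The region `𝒟(m,n)`: the union of the boxes `[-z, z]` over all positive weight vectors `z` for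
which the partition is compatible with `z`, so that `𝐆(m,n)` is defined, and `𝐆(m,n)` is primitive,
so that `λ₁(𝐆(m,n))` is defined, and `λ₁(𝐆(m,n)) < 1`. -/
def region [L.IsLattice] (κ : Kind) {m n t : ℕ} (hmn : m < n)
    (P : Fin t → Set (L.Walk m)) (γ : Fin t → L.Walk m) : Set (L.EdgeClass → ℝ) :=
  ⋃ z ∈ {z : L.EdgeClass → ℝ | (∀ i, 0 < z i) ∧ IsCompatible z P ∧
    (matG κ z hmn P γ).IsPrimitive ∧
    ∃ l : ℝ, IsDominantEigenvalue (matG κ z hmn P γ) l ∧ l < 1}, Set.Icc (-z) z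

/-! ### The anisotropic generating function -/

/-- `c_𝐧`: the number of SAWs (SATs) that start from the vertex `o` and contain exactly `ν i` edges
of the class `i`, for every `i`. Such a walk has `∑ i, ν i` steps. -/
noncomputable def coeff [L.IsLattice] (κ : Kind) (o : L.Vertex) (ν : L.EdgeClass → ℕ) : ℕ :=
  Nat.card {W : L.Walk (∑ i, ν i) // W.IsAvoiding κ ∧ W.start = o ∧ W.count = ν}

/-- The term `c_𝐧 x^𝐧` of the generating function. -/
noncomputable def genTerm [L.IsLattice] (κ : Kind) (o : L.Vertex) (x : L.EdgeClass → ℝ)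
    (ν : L.EdgeClass → ℕ) : ℝ :=
  (coeff κ o ν : ℝ) * ∏ i, x i ^ ν i

end DrawnGraph

end SAW

/-! Put `p = n - m`. An `(N + p)`-step SAW that extends `γ r` is determined by its first `n` steps
`U` and its last `N` steps, and these pieces overlap in the last `m` steps of `U`. Both pieces are
self-avoiding, while a compatible pair of pieces may fail to glue to a SAW, so cutting yields an
inequality. The overlap is a translation of a walk in some `P s`, and compatibility supplies a
weight-preserving symmetry that carries its extensions to those of `γ s`. Hence the normalized sums
`a N r = extSum κ z N (γ r) / weight z (γ r)` satisfy `a (N + p) ≤ G (a N)` entrywise for `N ≥ m`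
(`extSum_div_weight_le`).

If `λ₁(G) < 1`, all complex eigenvalues of `G` lie in the open unit disc, so the powers of `G` are
summable by Gelfand's formula. Iterating the recurrence along residue classes modulo `p` shows that
the total weight at `z` of all SAWs from any vertex is finite (`Admissible.summable_weight`). It
dominates the series at every `x` with `|x i| ≤ z i`.

Replacing `z` by `c • z` multiplies `G` by `c ^ p`, so some `c > 1` is still admissible. Each box
thus lies inside a larger open one, which makes the region open. On that open box, after rescaling
the coordinates by `z`, the walks of length `N` form the degree-`N` term of a power series whose
coefficient norms are bounded by a summable sequence. This gives analyticity. -/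

namespace SAW

open scoped NNReal ENNReal
open Filter

/-! ### Linear algebra: summable powers and contracting recurrences -/

/-- The powers of an element of spectral radius less than one are absolutely summable. -/
theorem summable_norm_pow_of_spectralRadius_lt_one {A : Type*} [NormedRing A] [NormedAlgebra ℂ A]
    [CompleteSpace A] (a : A) (h : spectralRadius ℂ a < 1) : Summable fun q : ℕ => ‖a ^ q‖ := by
  obtain ⟨r, hr, hr1⟩ := ENNReal.lt_iff_exists_nnreal_btwn.1 h
  have hr1' : r < 1 := by exact_mod_cast hr1
  -- Gelfand's formula: eventually `‖a ^ q‖ ^ (1 / q) < r < 1`, so the powers are dominated by a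
  -- geometric series.
  have hev := (spectrum.pow_nnnorm_pow_one_div_tendsto_nhds_spectralRadius a).eventually_lt_const hr
  refine Summable.of_norm_bounded_eventually_nat
    (summable_geometric_of_lt_one r.coe_nonneg (by exact_mod_cast hr1')) ?_
  filter_upwards [hev, eventually_gt_atTop 0] with q hq hq0
  have hq0' : (0 : ℝ) < q := by exact_mod_cast hq0
  have h2 : ((‖a ^ q‖₊ : ℝ≥0∞)) ≤ (r : ℝ≥0∞) ^ q := by
    have := ENNReal.rpow_le_rpow hq.le hq0'.le
    rwa [← ENNReal.rpow_mul, one_div_mul_cancel hq0'.ne', ENNReal.rpow_one,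
      ENNReal.rpow_natCast] at this
  have h3 : ‖a ^ q‖₊ ≤ r ^ q := by exact_mod_cast h2
  rw [norm_norm]
  exact_mod_cast h3

/-- A complex matrix whose eigenvalues lie in the open unit disc has absolutely summable powers. -/
theorem summable_norm_pow_apply_of_hasEigenvalue {t : ℕ} (B : Matrix (Fin t) (Fin t) ℂ)
    (h : ∀ μ : ℂ, Module.End.HasEigenvalue (Matrix.toLin' B) μ → ‖μ‖ < 1) (r s : Fin t) :
    Summable fun q : ℕ => ‖(B ^ q) r s‖ := by
  -- The maximal row sum norm makes the matrices a Banach algebra and bounds every entry.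
  let := Matrix.linftyOpNormedRing (n := Fin t) (α := ℂ)
  let := Matrix.linftyOpNormedAlgebra (n := Fin t) (R := ℂ) (α := ℂ)
  have : CompleteSpace (Matrix (Fin t) (Fin t) ℂ) := FiniteDimensional.complete ℂ _
  have : Nonempty (Fin t) := ⟨r⟩
  have hsr : spectralRadius ℂ B < 1 := by
    have := spectrum.spectralRadius_lt_of_forall_lt B (r := 1) ?_
    · simpa using this
    · intro μ hμ
      rw [← NNReal.coe_lt_coe]
      refine h μ ?_
      rw [Module.End.hasEigenvalue_iff_mem_spectrum]
      exact (AlgEquiv.spectrum_eq (Matrix.toLinAlgEquiv' (R := ℂ) (n := Fin t)) B).symm ▸ hμ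
  refine Summable.of_nonneg_of_le (fun _ => norm_nonneg _) (fun q => ?_)
    (summable_norm_pow_of_spectralRadius_lt_one B hsr)
  rw [Matrix.linfty_opNorm_def]
  have h1 : ‖(B ^ q) r s‖₊ ≤ ∑ j, ‖(B ^ q) r j‖₊ :=
    Finset.single_le_sum (f := fun j => ‖(B ^ q) r j‖₊) (fun _ _ => zero_le) (Finset.mem_univ s)
  have h2 := h1.trans (Finset.le_sup (f := fun i => ∑ j, ‖(B ^ q) i j‖₊) (Finset.mem_univ r))
  exact_mod_cast h2

/-- The dominant eigenvalue of a nonnegative matrix is nonnegative. -/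
theorem DrawnGraph.IsDominantEigenvalue.nonneg {t : ℕ} {A : Matrix (Fin t) (Fin t) ℝ} {l : ℝ}
    (hA : ∀ r s, 0 ≤ A r s) (hl : DrawnGraph.IsDominantEigenvalue A l) : 0 ≤ l := by
  -- If `l < 0`, no other eigenvalue can have absolute value below `l`, so `l` is the only one. The
  -- trace is then `t * l < 0`, against the nonnegativity of the entries.
  by_contra! hneg
  have hall : ∀ μ : ℂ, Module.End.HasEigenvalue
      (Matrix.toLin' (A.map (fun a : ℝ => (a : ℂ)))) μ → μ = (l : ℂ) := by
    intro μ hμ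
    by_contra hne
    exact absurd (hl.2 μ hμ hne) (not_lt.2 (hneg.le.trans (norm_nonneg _)))
  have hroots : (A.map (fun a : ℝ => (a : ℂ))).charpoly.roots
      = Multiset.replicate t (l : ℂ) := by
    refine Multiset.eq_replicate.2 ⟨?_, ?_⟩
    · rw [← (IsAlgClosed.splits _).natDegree_eq_card_roots, Matrix.charpoly_natDegree_eq_dim,
        Fintype.card_fin]
    · intro μ hμ
      refine hall μ ?_
      rw [Module.End.hasEigenvalue_iff_isRoot_charpoly, Matrix.charpoly_toLin']
      exact (Polynomial.mem_roots'.1 hμ).2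
  have htr := Matrix.trace_eq_sum_roots_charpoly (A.map (fun a : ℝ => (a : ℂ)))
  rw [hroots, Multiset.sum_replicate, nsmul_eq_mul] at htr
  have htr' : A.trace = t * l := by
    have : ((A.trace : ℝ) : ℂ) = ((t * l : ℝ) : ℂ) := by
      push_cast
      rw [← htr]
      simp [Matrix.trace]
    exact_mod_cast this
  have h0 : 0 ≤ A.trace := Finset.sum_nonneg fun i _ => hA i i
  have ht : 0 < t := by
    obtain ⟨x, hx⟩ := hl.1.exists_hasEigenvector
    rcases Nat.eq_zero_or_pos t with rfl | h
    · exact absurd (Subsingleton.elim x 0) hx.2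
    · exact h
  have : (0 : ℝ) < t := by exact_mod_cast ht
  nlinarith

/-- A nonnegative matrix with dominant eigenvalue less than one has summable powers. -/
theorem summable_pow_apply_of_isDominantEigenvalue {t : ℕ} {A : Matrix (Fin t) (Fin t) ℝ} {l : ℝ}
    (hA : ∀ r s, 0 ≤ A r s) (hl : DrawnGraph.IsDominantEigenvalue A l) (hl1 : l < 1)
    (r s : Fin t) : Summable fun q : ℕ => (A ^ q) r s := by
  have h := summable_norm_pow_apply_of_hasEigenvalue (A.map (fun a : ℝ => (a : ℂ))) ?_ r s
  · refine Summable.of_norm (h.congr fun q => ?_)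
    have : (A.map (fun a : ℝ => (a : ℂ))) ^ q = (A ^ q).map (fun a : ℝ => (a : ℂ)) :=
      (Matrix.map_pow A Complex.ofRealHom q).symm
    rw [this]
    simp
  · intro μ hμ
    by_cases hne : μ = (l : ℂ)
    · rw [hne, Complex.norm_real, Real.norm_of_nonneg (hl.nonneg hA)]
      exact hl1
    · exact (hl.2 μ hμ hne).trans hl1

/-- Summability along all residue classes. -/
theorem summable_of_summable_add_mul {f : ℕ → ℝ} (p : ℕ) (hp : 0 < p)
    (h : ∀ j, Summable fun q : ℕ => ‖f (j + q * p)‖) : Summable f := by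
  have : NeZero p := ⟨hp.ne'⟩
  have h1 : Summable fun x : Fin p × ℕ => ‖f (x.1 + x.2 * p)‖ :=
    (summable_prod_of_nonneg fun _ => norm_nonneg _).2 ⟨fun j => h j, Summable.of_finite⟩
  have h2 := ((Nat.divModEquiv p).trans (Equiv.prodComm _ _)).summable_iff.2 h1
  refine Summable.of_norm (h2.congr fun N => ?_)
  simp [Nat.divModEquiv, Nat.mod_add_div']

/-- A nonnegative vector-valued sequence that contracts by a matrix with summable powers at every
`p` steps is summable. -/
theorem summable_of_le_mulVec {t p m : ℕ} (hp : 0 < p) {A : Matrix (Fin t) (Fin t) ℝ}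
    (hA : ∀ r s, 0 ≤ A r s) (hsum : ∀ r s, Summable fun q : ℕ => (A ^ q) r s)
    {a : ℕ → Fin t → ℝ} (h0 : ∀ N r, 0 ≤ a N r)
    (hrec : ∀ N r, m ≤ N → a (N + p) r ≤ ∑ s, A r s * a N s) (r : Fin t) :
    Summable fun N => a N r := by
  -- The recurrence holds only from index `m` on; finitely many terms do not matter.
  rw [← summable_nat_add_iff m]
  refine summable_of_summable_add_mul p hp fun j => ?_
  have hle : ∀ q r, a (j + q * p + m) r ≤ ∑ s, (A ^ q) r s * a (j + m) s := by
    intro q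
    induction q with
    | zero => intro r; simp [Matrix.one_apply]
    | succ q ih =>
      intro r
      calc a (j + (q + 1) * p + m) r = a (j + q * p + m + p) r := by ring_nf
        _ ≤ ∑ s, A r s * a (j + q * p + m) s := hrec _ _ (by omega)
        _ ≤ ∑ s, A r s * ∑ u, (A ^ q) s u * a (j + m) u :=
          Finset.sum_le_sum fun s _ => mul_le_mul_of_nonneg_left (ih s) (hA r s)
        _ = ∑ u, (A ^ (q + 1)) r u * a (j + m) u := by
          simp only [pow_succ', Matrix.mul_apply, Finset.mul_sum, Finset.sum_mul, mul_assoc]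
          exact Finset.sum_comm
  refine Summable.of_nonneg_of_le (fun _ => norm_nonneg _) (fun q => ?_)
    (summable_sum (s := Finset.univ) fun s _ => (hsum r s).mul_right (a (j + m) s))
  rw [Real.norm_of_nonneg (h0 _ _)]
  exact hle q r

namespace DrawnGraph

variable {D : ℕ} {L : DrawnGraph D}

/-! ### Walks, their pieces and their weights -/

/-- The end of an edge is determined by the edge and the vertex from which it is traversed. -/
theorem Joins.unique {e : L.Edge} {u w w' : L.Vertex} (h : L.Joins e u w) (h' : L.Joins e u w') :
    w = w' := by
  obtain ⟨a, -, b, -, hd, -⟩ := L.drawn e.1 e.2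
  unfold Joins at h h'
  apply Subtype.ext
  rcases hd with hd | hd <;> rw [hd] at h h' <;>
    simp only [Set.mem_singleton_iff, Set.mem_insert_iff, Prod.mk.injEq] at h h'
  · rw [h.2, h'.2]
  · rcases h with ⟨h1, h2⟩ | ⟨h1, h2⟩ <;> rcases h' with ⟨h3, h4⟩ | ⟨h3, h4⟩ <;> simp_all

namespace Walk

theorem ext' {n : ℕ} {W W' : L.Walk n} (hv : ∀ i, W.vert i = W'.vert i)
    (he : ∀ i, W.edge i = W'.edge i) : W = W' := by
  cases W
  cases W'
  simp only [Walk.mk.injEq]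
  exact ⟨funext hv, funext he⟩

theorem segment_segment {n i k j l : ℕ} (W : L.Walk n) (h : i + k ≤ n) (h' : j + l ≤ k)
    (h'' : i + j + l ≤ n) : (W.segment i k h).segment j l h' = W.segment (i + j) l h'' :=
  ext' (fun _ => congrArg W.vert (Fin.ext (by simp [add_assoc])))
    (fun _ => congrArg W.edge (Fin.ext (by simp [add_assoc])))

theorem segment_congr {n i j k : ℕ} (W : L.Walk n) (hij : i = j) (h : i + k ≤ n) :
    W.segment i k h = W.segment j k (hij ▸ h) := by
  subst hij
  rfl

theorem IsAvoiding.segment {κ : Kind} {n i k : ℕ} {W : L.Walk n} (hW : W.IsAvoiding κ)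
    (h : i + k ≤ n) : (W.segment i k h).IsAvoiding κ := by
  cases κ with
  | saw =>
    intro a b hab
    have := hW hab
    simp only [Fin.mk.injEq, add_right_inj] at this
    exact Fin.ext this
  | sat =>
    intro a b hab
    have := hW hab
    simp only [Fin.mk.injEq, add_right_inj] at this
    exact Fin.ext this

/-- A walk is determined by two pieces that cover it. -/
theorem eq_of_segments {M a p N : ℕ} {W W' : L.Walk M} (hM : p + N = M) (hpa : p ≤ a)
    (ha : 0 + a ≤ M) (h1 : W.segment 0 a ha = W'.segment 0 a ha)
    (h2 : W.segment p N hM.le = W'.segment p N hM.le) : W = W' := by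
  refine ext' (fun i => ?_) (fun i => ?_)
  · by_cases hi : (i : ℕ) ≤ a
    · have := congrFun (congrArg Walk.vert h1) ⟨i, by omega⟩
      simpa [Walk.segment] using this
    · have := congrFun (congrArg Walk.vert h2) ⟨i - p, by omega⟩
      have hi' : p + (i - p) = i := by omega
      simpa [Walk.segment, hi'] using this
  -- Strict here: an `a`-step piece has vertices `0, …, a` but only edges `0, …, a - 1`.
  · by_cases hi : (i : ℕ) < a
    · have := congrFun (congrArg Walk.edge h1) ⟨i, by omega⟩
      simpa [Walk.segment] using this
    · have := congrFun (congrArg Walk.edge h2) ⟨i - p, by omega⟩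
      have hi' : p + (i - p) = i := by omega
      simpa [Walk.segment, hi'] using this

/-- There are finitely many walks of a given length from a given vertex. -/
theorem finite_start [L.IsLattice] (n : ℕ) (o : L.Vertex) :
    {W : L.Walk n | W.start = o}.Finite := by
  induction n generalizing o with
  | zero =>
    refine Set.Subsingleton.finite fun W hW W' hW' => ext' (fun i => ?_) (fun i => i.elim0)
    rw [Fin.fin_one_eq_zero i]
    exact hW.trans hW'.symm
  | succ n ih =>
    -- The final vertex need not be recorded: by `Joins.unique` the last edge and its origin
    -- determine it. So finite out-degree suffices.
    let f : L.Walk (n + 1) → L.Walk n × L.Edge :=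
      fun W => (W.segment 0 n (by omega), W.edge (Fin.last n))
    have hcast : ∀ (W : L.Walk (n + 1)) (i : Fin (n + 1)),
        W.vert i.castSucc = (W.segment 0 n (by omega)).vert i :=
      fun W i => congrArg W.vert (Fin.ext (by simp))
    have hcast' : ∀ (W : L.Walk (n + 1)) (i : Fin n),
        W.edge i.castSucc = (W.segment 0 n (by omega)).edge i :=
      fun W i => congrArg W.edge (Fin.ext (by simp))
    have hfin : (⋃ V ∈ {V : L.Walk n | V.start = o},
        ({V} : Set (L.Walk n)) ×ˢ {e : L.Edge | ∃ w, L.Joins e V.finish w}).Finite :=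
      (ih o).biUnion fun V _ =>
        (Set.finite_singleton V).prod (IsLattice.finite_degree V.finish)
    refine Set.Finite.of_finite_image (hfin.subset ?_) (f := f) ?_
    · rintro _ ⟨W, hW, rfl⟩
      have hW' : (W.segment 0 n (by omega)).start = o := hW
      simp only [Set.mem_iUnion]
      refine ⟨_, hW', rfl, W.vert (Fin.last n).succ, ?_⟩
      have := W.joins (Fin.last n)
      rw [hcast] at this
      exact this
    · intro W _ W' _ hWW'
      obtain ⟨h1, h2⟩ := Prod.ext_iff.1 hWW'
      simp only [f] at h1 h2
      have hv : ∀ i : Fin (n + 1), W.vert i.castSucc = W'.vert i.castSucc := fun i => by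
        rw [hcast, hcast, h1]
      refine ext' (fun i => ?_) (fun i => ?_)
      · induction i using Fin.lastCases with
        | cast i => exact hv i
        | last =>
          have j1 := W.joins (Fin.last n)
          have j2 := W'.joins (Fin.last n)
          rw [← h2, ← hv] at j2
          exact j1.unique j2
      · induction i using Fin.lastCases with
        | cast i => rw [hcast', hcast', h1]
        | last => exact h2

theorem sum_count [L.IsLattice] {n : ℕ} (W : L.Walk n) : ∑ i, W.count i = n := by
  classical
  have := Finset.card_eq_sum_card_fiberwise (s := (Finset.univ : Finset (Fin n)))
    (t := (Finset.univ : Finset L.EdgeClass)) (f := fun j => L.edgeClass (W.edge j))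
    (fun _ _ => Finset.mem_coe.2 (Finset.mem_univ _))
  simp only [Finset.card_univ, Fintype.card_fin] at this
  refine Eq.trans (Finset.sum_congr rfl fun i _ => ?_) this.symm
  rw [count, Nat.card_eq_fintype_card, Fintype.card_subtype]

end Walk

/-- Grouping the steps by edge class gives a product over steps, in which scaling, cutting and
symmetries act factor by factor. -/
theorem weight_eq_prod [L.IsLattice] (z : L.EdgeClass → ℝ) {n : ℕ} (W : L.Walk n) :
    weight z W = ∏ j, z (L.edgeClass (W.edge j)) := by
  classical
  rw [← Finset.prod_fiberwise' Finset.univ (fun j => L.edgeClass (W.edge j)) z, weight]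
  refine Finset.prod_congr rfl fun i _ => ?_
  rw [Finset.prod_const, Walk.count, Nat.card_eq_fintype_card, Fintype.card_subtype]

theorem weight_pos [L.IsLattice] {z : L.EdgeClass → ℝ} (hz : ∀ i, 0 < z i) {n : ℕ}
    (W : L.Walk n) : 0 < weight z W :=
  Finset.prod_pos fun i _ => pow_pos (hz i) _

theorem weight_smul [L.IsLattice] (c : ℝ) (z : L.EdgeClass → ℝ) {n : ℕ} (W : L.Walk n) :
    weight (c • z) W = c ^ n * weight z W := by
  simp [weight_eq_prod, Finset.prod_mul_distrib]

theorem weight_mul [L.IsLattice] (y z : L.EdgeClass → ℝ) {n : ℕ} (W : L.Walk n) :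
    weight (y * z) W = weight y W * weight z W := by
  simp [weight_eq_prod, Finset.prod_mul_distrib]

theorem weight_eq_mul_segment [L.IsLattice] (z : L.EdgeClass → ℝ) {M p N : ℕ} (W : L.Walk M)
    (hM : p + N = M) :
    weight z W = weight z (W.segment 0 p (by omega)) * weight z (W.segment p N hM.le) := by
  subst hM
  simp only [weight_eq_prod, Fin.prod_univ_add, Walk.segment]
  congr 1
  refine Finset.prod_congr rfl fun j _ => ?_
  congr 3
  exact Fin.ext (by simp)

/-! ### Action of symmetries on walks -/

namespace Symm

/-- The inverse symmetry. -/
def inv (τ : L.Symm) : L.Symm where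
  onVert := τ.onVert.symm
  onEdge := τ.onEdge.symm
  joins_iff e u w := by
    rw [← τ.joins_iff]
    simp

/-- The composition of two symmetries. -/
def comp (σ τ : L.Symm) : L.Symm where
  onVert := τ.onVert.trans σ.onVert
  onEdge := τ.onEdge.trans σ.onEdge
  joins_iff e u w := by
    simp [σ.joins_iff, τ.joins_iff]

/-- The image of a walk under a symmetry. -/
def mapWalk (τ : L.Symm) {n : ℕ} (W : L.Walk n) : L.Walk n where
  vert i := τ.onVert (W.vert i)
  edge i := τ.onEdge (W.edge i)
  joins i := (τ.joins_iff _ _ _).2 (W.joins i)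

theorem mapsTo_iff (τ : L.Symm) {n : ℕ} (W W' : L.Walk n) : τ.MapsTo W W' ↔ W' = τ.mapWalk W :=
  ⟨fun h => Walk.ext' h.1 h.2, fun h => h ▸ ⟨fun _ => rfl, fun _ => rfl⟩⟩

theorem mapWalk_inv (τ : L.Symm) {n : ℕ} (W : L.Walk n) : τ.mapWalk (τ.inv.mapWalk W) = W :=
  Walk.ext' (fun i => by simp [mapWalk, inv]) (fun i => by simp [mapWalk, inv])

theorem inv_mapWalk (τ : L.Symm) {n : ℕ} (W : L.Walk n) : τ.inv.mapWalk (τ.mapWalk W) = W :=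
  Walk.ext' (fun i => by simp [mapWalk, inv]) (fun i => by simp [mapWalk, inv])

theorem isAvoiding_mapWalk (τ : L.Symm) {κ : Kind} {n : ℕ} {W : L.Walk n}
    (h : W.IsAvoiding κ) : (τ.mapWalk W).IsAvoiding κ := by
  cases κ with
  | saw => exact τ.onVert.injective.comp h
  | sat => exact τ.onEdge.injective.comp h

theorem IsWeightPreserving.inv {τ : L.Symm} {z : L.EdgeClass → ℝ} (h : τ.IsWeightPreserving z) :
    τ.inv.IsWeightPreserving z := fun e => by
  rw [h (τ.inv.onEdge e)]
  simp [Symm.inv]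

theorem IsWeightPreserving.comp {σ τ : L.Symm} {z : L.EdgeClass → ℝ}
    (h : σ.IsWeightPreserving z) (h' : τ.IsWeightPreserving z) :
    (σ.comp τ).IsWeightPreserving z := fun e => (h' e).trans (h _)

theorem IsWeightPreserving.weight_mapWalk [L.IsLattice] {τ : L.Symm} {z : L.EdgeClass → ℝ}
    (h : τ.IsWeightPreserving z) {n : ℕ} (W : L.Walk n) :
    weight z (τ.mapWalk W) = weight z W := by
  simp only [weight_eq_prod]
  exact Finset.prod_congr rfl fun j _ => (h _).symm

end Symm

/-- The symmetry given by a translation. -/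
noncomputable def translationSymm (a : Pt D) (ha : a ∈ L.translations) : L.Symm where
  onVert := Equiv.ofBijective (fun u => ⟨a + u, ha.1.subset ⟨u, u.2, rfl⟩⟩) <| by
    constructor
    · intro u w h
      exact Subtype.ext (add_left_cancel (congrArg Subtype.val h))
    · rintro ⟨w, hw⟩
      obtain ⟨u, hu, rfl⟩ := ha.1.superset hw
      exact ⟨⟨u, hu⟩, rfl⟩
  onEdge := Equiv.ofBijective
    (fun e => ⟨DrawnEdge.translate a e, ha.2.subset ⟨e, e.2, rfl⟩⟩) <| by
    constructor
    · intro e f h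
      have h' := congrArg (DrawnEdge.translate (-a)) (congrArg Subtype.val h)
      simp only [← DrawnEdge.translate_add, neg_add_cancel, DrawnEdge.translate_zero] at h'
      exact Subtype.ext h'
    · rintro ⟨f, hf⟩
      obtain ⟨e, he, rfl⟩ := ha.2.superset hf
      exact ⟨⟨e, he⟩, rfl⟩
  joins_iff e u w := by
    change (a + (u : Pt D), a + (w : Pt D)) ∈ (fun q : Pt D × Pt D => (a + q.1, a + q.2)) '' _ ↔ _
    simp [Joins]

theorem translationSymm_isWeightPreserving (a : Pt D) (ha : a ∈ L.translations)
    (z : L.EdgeClass → ℝ) : (translationSymm a ha).IsWeightPreserving z := fun _ =>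
  congrArg z (Quotient.sound ⟨a, ha, rfl⟩)

/-- `W'` is the image of `W` under a symmetry that is weight-preserving with respect to `z`. -/
def Related (z : L.EdgeClass → ℝ) {n : ℕ} (W W' : L.Walk n) : Prop :=
  ∃ τ : L.Symm, τ.IsWeightPreserving z ∧ W' = τ.mapWalk W

namespace Related

variable {z : L.EdgeClass → ℝ} {n : ℕ} {W W' W'' : L.Walk n}

theorem symm (h : Related z W W') : Related z W' W := by
  obtain ⟨τ, hτ, rfl⟩ := h
  exact ⟨τ.inv, hτ.inv, (τ.inv_mapWalk W).symm⟩

theorem trans (h : Related z W W') (h' : Related z W' W'') : Related z W W'' := by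
  obtain ⟨τ, hτ, rfl⟩ := h
  obtain ⟨σ, hσ, rfl⟩ := h'
  exact ⟨σ.comp τ, hσ.comp hτ, rfl⟩

theorem weight_eq [L.IsLattice] (h : Related z W W') : weight z W = weight z W' := by
  obtain ⟨τ, hτ, rfl⟩ := h
  exact (hτ.weight_mapWalk W).symm

end Related

theorem Walk.IsTranslate.related {n : ℕ} {W W' : L.Walk n} (h : W.IsTranslate W')
    (z : L.EdgeClass → ℝ) : Related z W W' := by
  obtain ⟨a, ha, h1, h2⟩ := h
  exact ⟨translationSymm a ha, translationSymm_isWeightPreserving a ha z,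
    Walk.ext' (fun i => Subtype.ext (h1 i)) (fun i => Subtype.ext (h2 i))⟩

theorem IsCompatible.related {z : L.EdgeClass → ℝ} {m t : ℕ} {P : Fin t → Set (L.Walk m)}
    (h : IsCompatible z P) {s : Fin t} {W W' : L.Walk m} (hW : W ∈ P s) (hW' : W' ∈ P s) :
    Related z W W' := by
  obtain ⟨τ, hτ, hm⟩ := h s W hW W' hW'
  exact ⟨τ, hτ, (τ.mapsTo_iff W W').1 hm⟩

/-- Every self-avoiding walk is a translation of a walk in some part of the partition. -/
theorem IsPartition.exists_isTranslate {κ : Kind} {v : L.VertexClass → L.Vertex}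
    (hv : ∀ k, L.vertexClass (v k) = k) {m t : ℕ} {P : Fin t → Set (L.Walk m)}
    (hP : IsPartition κ v P) {W : L.Walk m} (hW : W.IsAvoiding κ) :
    ∃ s, ∃ δ ∈ P s, δ.IsTranslate W := by
  obtain ⟨a, ha, h⟩ : L.vertexSetoid.r W.start (v (L.vertexClass W.start)) :=
    Quotient.exact (hv (L.vertexClass W.start)).symm
  have hmem : (translationSymm a ha).mapWalk W ∈ ⋃ s, P s := by
    rw [hP.iUnion_eq]
    exact ⟨Symm.isAvoiding_mapWalk _ hW, L.vertexClass W.start, Subtype.ext h.symm⟩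
  obtain ⟨s, hs⟩ := Set.mem_iUnion.1 hmem
  refine ⟨s, _, hs, -a, neg_mem ha, fun i => ?_, fun i => ?_⟩
  · change (W.vert i : Pt D) = -a + (a + W.vert i)
    rw [neg_add_cancel_left]
  · change (W.edge i : DrawnEdge D) = DrawnEdge.translate (-a) (DrawnEdge.translate a (W.edge i))
    rw [← DrawnEdge.translate_add, neg_add_cancel, DrawnEdge.translate_zero]


/-! ### Extensions of a walk -/

/-- The `N`-step SAWs (SATs) whose first `m` steps form the walk `V`. -/
def extSet (κ : Kind) (N : ℕ) {m : ℕ} (V : L.Walk m) : Set (L.Walk N) :=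
  {W | W.IsAvoiding κ ∧ ∃ h : 0 + m ≤ N, W.segment 0 m h = V}

theorem finite_extSet [L.IsLattice] (κ : Kind) (N : ℕ) {m : ℕ} (V : L.Walk m) :
    (extSet κ N V).Finite := by
  refine (Walk.finite_start N V.start).subset ?_
  rintro W ⟨-, h, rfl⟩
  rfl

/-- The total weight of the `N`-step SAWs (SATs) whose first `m` steps form the walk `V`. -/
noncomputable def extSum [L.IsLattice] (κ : Kind) (z : L.EdgeClass → ℝ) (N : ℕ) {m : ℕ}
    (V : L.Walk m) : ℝ :=
  ∑ W ∈ (finite_extSet κ N V).toFinset, weight z W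

theorem extSum_nonneg [L.IsLattice] (κ : Kind) {z : L.EdgeClass → ℝ} (hz : ∀ i, 0 < z i) (N : ℕ)
    {m : ℕ} (V : L.Walk m) : 0 ≤ extSum κ z N V :=
  Finset.sum_nonneg fun W _ => (weight_pos hz W).le

theorem Symm.mapWalk_mem_extSet (τ : L.Symm) {κ : Kind} {N m : ℕ} {V : L.Walk m} {W : L.Walk N}
    (h : W ∈ extSet κ N V) : τ.mapWalk W ∈ extSet κ N (τ.mapWalk V) := by
  obtain ⟨h1, h2, rfl⟩ := h
  exact ⟨τ.isAvoiding_mapWalk h1, h2, rfl⟩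

/-- A symmetry acts on the whole graph, so it maps the extensions of `V` bijectively to those of its
image, preserving self-avoidance and weight. -/
theorem Related.extSum_eq [L.IsLattice] {z : L.EdgeClass → ℝ} {m : ℕ} {V V' : L.Walk m}
    (h : Related z V V') (κ : Kind) (N : ℕ) : extSum κ z N V = extSum κ z N V' := by
  obtain ⟨τ, hτ, rfl⟩ := h
  refine Finset.sum_nbij' τ.mapWalk τ.inv.mapWalk ?_ ?_ ?_ ?_ ?_
  · intro W hW
    rw [Set.Finite.mem_toFinset] at hW ⊢
    exact τ.mapWalk_mem_extSet hW
  · intro W hW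
    rw [Set.Finite.mem_toFinset] at hW ⊢
    have := τ.inv.mapWalk_mem_extSet hW
    rwa [τ.inv_mapWalk] at this
  · exact fun W _ => τ.inv_mapWalk W
  · exact fun W _ => τ.mapWalk_inv W
  · exact fun W _ => (hτ.weight_mapWalk W).symm

/-- The set of walks that contribute to the entry `(r, s)` of the matrix `𝐅(m,n)`. -/
def matSet (κ : Kind) {m n t : ℕ} (hmn : m < n) (P : Fin t → Set (L.Walk m))
    (γ : Fin t → L.Walk m) (r s : Fin t) : Set (L.Walk n) :=
  {W : L.Walk n | W.IsAvoiding κ ∧ W.segment 0 m (by omega) = γ r ∧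
    ∃ δ ∈ P s, δ.IsTranslate (W.segment (n - m) m (by omega))}

theorem finite_matSet [L.IsLattice] (κ : Kind) {m n t : ℕ} (hmn : m < n)
    (P : Fin t → Set (L.Walk m)) (γ : Fin t → L.Walk m) (r s : Fin t) :
    (matSet κ hmn P γ r s).Finite :=
  (finite_extSet κ n (γ r)).subset fun _ hW => ⟨hW.1, by omega, hW.2.1⟩

theorem matF_eq_sum [L.IsLattice] (κ : Kind) (z : L.EdgeClass → ℝ) {m n t : ℕ} (hmn : m < n)
    (P : Fin t → Set (L.Walk m)) (γ : Fin t → L.Walk m) (r s : Fin t) :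
    matF κ z hmn P γ r s = ∑ W ∈ (finite_matSet κ hmn P γ r s).toFinset, weight z W :=
  finsum_mem_eq_finite_toFinset_sum _ (finite_matSet κ hmn P γ r s)

/-- The numerator has degree `n` and the denominator degree `m` in the edge weights. -/
theorem matG_smul [L.IsLattice] (κ : Kind) {c : ℝ} (hc : 0 < c) (z : L.EdgeClass → ℝ) {m n t : ℕ}
    (hmn : m < n) (P : Fin t → Set (L.Walk m)) (γ : Fin t → L.Walk m) :
    matG κ (c • z) hmn P γ = c ^ (n - m) • matG κ z hmn P γ := by
  ext r s
  simp only [matG, Matrix.of_apply, Matrix.smul_apply, matF_eq_sum, weight_smul, ← Finset.mul_sum,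
    smul_eq_mul]
  rw [mul_div_mul_comm, ← pow_sub₀ _ hc.ne' hmn.le |>.trans (div_eq_mul_inv _ _).symm]

/-- Splitting the walks after `n` steps bounds the extensions of a walk by those of its final
pieces. -/
theorem extSum_add_le_sum [L.IsLattice] (κ : Kind) {z : L.EdgeClass → ℝ} (hz : ∀ i, 0 < z i)
    {m n N : ℕ} (hmn : m < n) (hN : m ≤ N) (V : L.Walk m) :
    extSum κ z (N + (n - m)) V ≤ ∑ U ∈ (finite_extSet κ n V).toFinset,
      weight z U * (extSum κ z N (U.segment (n - m) m (by omega)) /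
        weight z (U.segment (n - m) m (by omega))) := by
  classical
  -- The two pieces share `m` steps, whose weight is counted twice in the product; `g` divides it
  -- out once.
  let f : L.Walk (N + (n - m)) → (_ : L.Walk n) × L.Walk N :=
    fun W => ⟨W.segment 0 n (by omega), W.segment (n - m) N (by omega)⟩
  let g : (_ : L.Walk n) × L.Walk N → ℝ := fun x =>
    weight z x.1 * (weight z x.2 / weight z (x.1.segment (n - m) m (by omega)))
  have hf : Function.Injective f := fun W W' h => by
    simp only [f, Sigma.mk.injEq, heq_eq_eq] at h
    exact Walk.eq_of_segments (by omega) (by omega : n - m ≤ n) _ h.1 h.2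
  have hfg : ∀ W, weight z W = g (f W) := by
    intro W
    have h1 := weight_eq_mul_segment z W (p := n - m) (N := N) (by omega)
    have h2 := weight_eq_mul_segment z (W.segment 0 n (by omega)) (p := n - m) (N := m) (by omega)
    rw [Walk.segment_segment _ _ _ (by omega)] at h2
    have h3 := weight_pos hz ((W.segment 0 n (by omega)).segment (n - m) m (by omega))
    simp only [g, f]
    rw [h2, mul_assoc, mul_div_cancel₀ _ h3.ne', h1]
  simp only [extSum, Finset.sum_div, Finset.mul_sum]
  rw [Finset.sum_sigma' _ _ (fun U W' =>
    weight z U * (weight z W' / weight z (U.segment (n - m) m (by omega))))]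
  simp only [hfg]
  rw [← Finset.sum_image (f := g) hf.injOn]
  -- Pairs outside the image of `f`, such as those whose gluing intersects itself, only add
  -- nonnegative terms.
  refine Finset.sum_le_sum_of_subset_of_nonneg ?_ fun x _ _ => ?_
  · intro x hx
    obtain ⟨W, hW, rfl⟩ := Finset.mem_image.1 hx
    rw [Set.Finite.mem_toFinset] at hW
    obtain ⟨h1, h2, rfl⟩ := hW
    simp only [f, Finset.mem_sigma, Set.Finite.mem_toFinset]
    refine ⟨⟨h1.segment _, by omega, ?_⟩, h1.segment _, by omega, ?_⟩
    · exact Walk.segment_segment _ _ _ _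
    · rw [Walk.segment_segment _ _ _ (by omega), Walk.segment_segment _ _ _ (by omega)]
      exact Walk.segment_congr _ (by omega) _
  · exact mul_nonneg (weight_pos hz _).le (div_nonneg (weight_pos hz _).le (weight_pos hz _).le)

/-- The recurrence for the normalized total weights of extensions. -/
theorem extSum_div_weight_le [L.IsLattice] {κ : Kind} {z : L.EdgeClass → ℝ} (hz : ∀ i, 0 < z i)
    {v : L.VertexClass → L.Vertex} (hv : ∀ k, L.vertexClass (v k) = k) {m n N t : ℕ}
    (hmn : m < n) (hN : m ≤ N) {P : Fin t → Set (L.Walk m)} (hP : IsPartition κ v P)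
    {γ : Fin t → L.Walk m} (hγ : ∀ r, γ r ∈ P r) (hPz : IsCompatible z P) (r : Fin t) :
    extSum κ z (N + (n - m)) (γ r) / weight z (γ r) ≤
      ∑ s, matG κ z hmn P γ r s * (extSum κ z N (γ s) / weight z (γ s)) := by
  classical
  have hpos : ∀ s, 0 ≤ extSum κ z N (γ s) / weight z (γ s) := fun s =>
    div_nonneg (extSum_nonneg κ hz N _) (weight_pos hz _).le
  have hsum : ∑ s, matG κ z hmn P γ r s * (extSum κ z N (γ s) / weight z (γ s)) =
      (∑ s, ∑ U ∈ (finite_extSet κ n (γ r)).toFinset, if U ∈ matSet κ hmn P γ r s then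
        weight z U * (extSum κ z N (γ s) / weight z (γ s)) else 0) / weight z (γ r) := by
    rw [Finset.sum_div]
    refine Finset.sum_congr rfl fun s _ => ?_
    rw [matG, Matrix.of_apply, matF_eq_sum, div_mul_eq_mul_div, Finset.sum_mul,
      ← Finset.sum_filter]
    congr 1
    refine Finset.sum_congr ?_ fun _ _ => rfl
    ext U
    simp only [Set.Finite.mem_toFinset, Finset.mem_filter]
    exact ⟨fun h => ⟨⟨h.1, by omega, h.2.1⟩, h⟩, fun h => h.2⟩
  rw [hsum, Finset.sum_comm]
  refine div_le_div_of_nonneg_right ?_ (weight_pos hz _).le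
  refine (extSum_add_le_sum κ hz hmn hN (γ r)).trans (Finset.sum_le_sum fun U hU => ?_)
  rw [Set.Finite.mem_toFinset] at hU
  obtain ⟨h1, h2, h3⟩ := hU
  obtain ⟨s, δ, hδ, htr⟩ := hP.exists_isTranslate hv
    (h1.segment (show n - m + m ≤ n by omega))
  have hrel : Related z (U.segment (n - m) m (by omega)) (γ s) :=
    (htr.related z).symm.trans (hPz.related hδ (hγ s))
  -- The term of `U` now depends on `s` alone. It is one summand of the right-hand side, and the
  -- other summands are nonnegative.
  rw [hrel.extSum_eq κ N, hrel.weight_eq]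
  refine le_trans (le_of_eq ?_) (Finset.single_le_sum (f := fun s =>
    if U ∈ matSet κ hmn P γ r s then
      weight z U * (extSum κ z N (γ s) / weight z (γ s)) else 0) (fun s _ => ?_)
      (Finset.mem_univ s))
  · rw [if_pos]
    exact ⟨h1, h3, δ, hδ, htr⟩
  · split_ifs
    · exact mul_nonneg (weight_pos hz _).le (hpos s)
    · exact le_rfl

/-! ### Summability -/

/-- The conditions on the weight vectors whose boxes form the region `𝒟(m,n)`. -/
def Admissible [L.IsLattice] (κ : Kind) {m n t : ℕ} (hmn : m < n)
    (P : Fin t → Set (L.Walk m)) (γ : Fin t → L.Walk m) (z : L.EdgeClass → ℝ) : Prop :=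
  (∀ i, 0 < z i) ∧ IsCompatible z P ∧ (matG κ z hmn P γ).IsPrimitive ∧
    ∃ l : ℝ, IsDominantEigenvalue (matG κ z hmn P γ) l ∧ l < 1

theorem mem_region_iff [L.IsLattice] {κ : Kind} {m n t : ℕ} {hmn : m < n}
    {P : Fin t → Set (L.Walk m)} {γ : Fin t → L.Walk m} {x : L.EdgeClass → ℝ} :
    x ∈ region κ hmn P γ ↔ ∃ z, Admissible κ hmn P γ z ∧ x ∈ Set.Icc (-z) z := by
  simp only [region, Set.mem_iUnion, Set.mem_ofPred_eq, exists_prop]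
  rfl

/-- The matrix recurrence treats the representatives `γ s`; a translation followed by a
weight-preserving symmetry reaches any other `m`-step SAW. -/
theorem Admissible.summable_extSum [L.IsLattice] {κ : Kind} {v : L.VertexClass → L.Vertex}
    (hv : ∀ k, L.vertexClass (v k) = k) {m n t : ℕ} {hmn : m < n} {P : Fin t → Set (L.Walk m)}
    (hP : IsPartition κ v P) {γ : Fin t → L.Walk m} (hγ : ∀ r, γ r ∈ P r)
    {z : L.EdgeClass → ℝ} (hz : Admissible κ hmn P γ z) {V : L.Walk m} (hV : V.IsAvoiding κ) :
    Summable fun N => extSum κ z N V := by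
  obtain ⟨hpos, hcomp, hprim, l, hl, hl1⟩ := hz
  obtain ⟨s, δ, hδ, htr⟩ := hP.exists_isTranslate hv hV
  have hrel : Related z V (γ s) := (htr.related z).symm.trans (hcomp.related hδ (hγ s))
  have h := summable_of_le_mulVec (Nat.sub_pos_of_lt hmn) hprim.nonneg
    (summable_pow_apply_of_isDominantEigenvalue hprim.nonneg hl hl1)
    (a := fun N s => extSum κ z N (γ s) / weight z (γ s)) (m := m)
    (fun N s => div_nonneg (extSum_nonneg κ hpos N _) (weight_pos hpos _).le)
    (fun N r hN => extSum_div_weight_le hpos hv hmn hN hP hγ hcomp r) s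
  refine (h.mul_right (weight z (γ s))).congr fun N => ?_
  rw [div_mul_cancel₀ _ (weight_pos hpos _).ne', hrel.extSum_eq κ N]

/-- The `N`-step SAWs (SATs) that start from the vertex `o`. -/
abbrev AvoidingFrom (κ : Kind) (o : L.Vertex) (N : ℕ) : Type :=
  {W : L.Walk N // W.IsAvoiding κ ∧ W.start = o}

noncomputable instance [L.IsLattice] (κ : Kind) (o : L.Vertex) (N : ℕ) :
    Fintype (AvoidingFrom κ o N) :=
  ((Walk.finite_start N o).subset fun _ hW => hW.2 :
    {W : L.Walk N | W.IsAvoiding κ ∧ W.start = o}.Finite).fintype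

/-- Each walk is counted under its own first `m` steps. -/
theorem sum_weight_le [L.IsLattice] (κ : Kind) {z : L.EdgeClass → ℝ} (hz : ∀ i, 0 < z i)
    (o : L.Vertex) {m N : ℕ} (hN : m ≤ N) :
    ∑ W : AvoidingFrom κ o N, weight z W.1 ≤ ∑ V : AvoidingFrom κ o m, extSum κ z N V.1 := by
  classical
  let f : AvoidingFrom κ o N → (_ : AvoidingFrom κ o m) × L.Walk N :=
    fun W => ⟨⟨W.1.segment 0 m (by omega), W.2.1.segment _, W.2.2⟩, W.1⟩
  have hf : Function.Injective f := fun W W' h => by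
    simp only [f, Sigma.mk.injEq, heq_eq_eq] at h
    exact Subtype.ext h.2
  simp only [extSum]
  rw [Finset.sum_sigma' _ _ (fun _ W => weight z W)]
  rw [← Finset.sum_image (f := fun x : (_ : AvoidingFrom κ o m) × L.Walk N => weight z x.2)
    (g := f) hf.injOn]
  refine Finset.sum_le_sum_of_subset_of_nonneg ?_ fun x _ _ => (weight_pos hz _).le
  intro x hx
  obtain ⟨W, -, rfl⟩ := Finset.mem_image.1 hx
  simp only [f, Finset.mem_sigma, Finset.mem_univ, true_and, Set.Finite.mem_toFinset]
  exact ⟨W.2.1, by omega, rfl⟩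

theorem Admissible.summable_weight [L.IsLattice] {κ : Kind} {v : L.VertexClass → L.Vertex}
    (hv : ∀ k, L.vertexClass (v k) = k) {m n t : ℕ} {hmn : m < n} {P : Fin t → Set (L.Walk m)}
    (hP : IsPartition κ v P) {γ : Fin t → L.Walk m} (hγ : ∀ r, γ r ∈ P r)
    {z : L.EdgeClass → ℝ} (hz : Admissible κ hmn P γ z) (o : L.Vertex) :
    Summable fun p : Σ N, AvoidingFrom κ o N => weight z p.2.1 := by
  refine (summable_sigma_of_nonneg fun p => (weight_pos hz.1 _).le).2
    ⟨fun _ => Summable.of_finite, ?_⟩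
  simp only [tsum_fintype]
  have h : Summable fun N => ∑ V : AvoidingFrom κ o m, extSum κ z N V.1 :=
    summable_sum fun V _ => hz.summable_extSum hv hP hγ V.2.1
  -- For `N < m` the sums `extSum` are empty and bound nothing, so the comparison starts at `N = m`.
  rw [← summable_nat_add_iff m] at h ⊢
  exact Summable.of_nonneg_of_le (fun _ => Finset.sum_nonneg fun W _ => (weight_pos hz.1 _).le)
    (fun N => sum_weight_le κ hz.1 o (by omega)) h

/-! ### Enlarging boxes, and openness of the region -/

/-- Scaling `z` multiplies the matrix by the positive number `c ^ (n - m)`. Compatibility and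
primitivity survive, and `c ^ (n - m) * l < 1` still holds for `c` slightly above `1`. -/
theorem Admissible.exists_one_lt_smul [L.IsLattice] {κ : Kind} {m n t : ℕ} {hmn : m < n}
    {P : Fin t → Set (L.Walk m)} {γ : Fin t → L.Walk m} {z : L.EdgeClass → ℝ}
    (hz : Admissible κ hmn P γ z) : ∃ c : ℝ, 1 < c ∧ Admissible κ hmn P γ (c • z) := by
  obtain ⟨hpos, hcomp, hprim, l, hl, hl1⟩ := hz
  have hcont : Filter.Tendsto (fun c : ℝ => c ^ (n - m) * l) (nhdsWithin 1 (Set.Ioi 1))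
      (nhds (1 ^ (n - m) * l)) :=
    (((continuous_id.pow _).mul continuous_const).tendsto 1).mono_left nhdsWithin_le_nhds
  rw [one_pow, one_mul] at hcont
  obtain ⟨c, hcl, hc1 : 1 < c⟩ :=
    ((hcont.eventually_lt_const hl1).and self_mem_nhdsWithin).exists
  have hc : 0 < c := one_pos.trans hc1
  have hcp : 0 < c ^ (n - m) := pow_pos hc _
  refine ⟨c, hc1, fun i => mul_pos hc (hpos i), fun s W hW W' hW' => ?_, ?_,
    c ^ (n - m) * l, ?_, hcl⟩
  · obtain ⟨τ, hτ, hm⟩ := hcomp s W hW W' hW'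
    exact ⟨τ, fun e => by simp [hτ e], hm⟩
  · rw [matG_smul κ hc]
    obtain ⟨k, hk, hkpos⟩ := hprim.exists_pos_pow
    refine ⟨fun r s => mul_nonneg hcp.le (hprim.nonneg r s), k, hk, fun r s => ?_⟩
    rw [smul_pow]
    exact mul_pos (pow_pos hcp _) (hkpos r s)
  · rw [matG_smul κ hc]
    set b := c ^ (n - m)
    set A := matG κ z hmn P γ
    constructor
    · obtain ⟨x, hx⟩ := hl.1.exists_hasEigenvector
      refine Module.End.hasEigenvalue_of_hasEigenvector (x := x)
        (Module.End.hasEigenvector_iff.2 ⟨Module.End.mem_eigenspace_iff.2 ?_, hx.2⟩)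
      have := hx.apply_eq_smul
      rw [map_smul, LinearMap.smul_apply, this, smul_smul]
    · intro μ hμ hne
      obtain ⟨x, hx⟩ := hμ.exists_hasEigenvector
      have hb : (b : ℂ) ≠ 0 := by exact_mod_cast hcp.ne'
      have hmap : (b • A).map (fun a : ℝ => (a : ℂ)) = (b : ℂ) • A.map (fun a : ℝ => (a : ℂ)) := by
        ext r s
        simp
      -- Dividing by `b` turns an eigenvalue of `b • A` into one of `A`, where strict dominance is
      -- known.
      have h1 : Module.End.HasEigenvalue (Matrix.toLin' (A.map (fun a : ℝ => (a : ℂ))))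
          ((b : ℂ)⁻¹ * μ) := by
        refine Module.End.hasEigenvalue_of_hasEigenvector (x := x)
          (Module.End.hasEigenvector_iff.2 ⟨Module.End.mem_eigenspace_iff.2 ?_, hx.2⟩)
        have := hx.apply_eq_smul
        rw [hmap, map_smul, LinearMap.smul_apply] at this
        rw [mul_smul, ← this, smul_smul, inv_mul_cancel₀ hb, one_smul]
      have h2 := hl.2 _ h1 fun h => hne (by
        push_cast
        rw [← h, mul_inv_cancel_left₀ hb])
      rw [norm_mul, norm_inv, Complex.norm_real, Real.norm_of_nonneg hcp.le,
        inv_mul_lt_iff₀ hcp] at h2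
      exact h2

/-- The box spanned by an admissible vector lies in the interior of a larger such box. -/
theorem exists_admissible_abs_lt [L.IsLattice] {κ : Kind} {m n t : ℕ} {hmn : m < n}
    {P : Fin t → Set (L.Walk m)} {γ : Fin t → L.Walk m} {x : L.EdgeClass → ℝ}
    (hx : x ∈ region κ hmn P γ) : ∃ z, Admissible κ hmn P γ z ∧ ∀ i, |x i| < z i := by
  obtain ⟨z, hz, hxz⟩ := mem_region_iff.1 hx
  obtain ⟨c, hc, hcz⟩ := hz.exists_one_lt_smul
  refine ⟨c • z, hcz, fun i => lt_of_le_of_lt (abs_le.2 ⟨hxz.1 i, hxz.2 i⟩) ?_⟩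
  have := hz.1 i
  simp only [Pi.smul_apply, smul_eq_mul]
  nlinarith

theorem isOpen_setOf_abs_lt {ι : Type*} [Finite ι] (z : ι → ℝ) :
    IsOpen {x : ι → ℝ | ∀ i, |x i| < z i} := by
  simp only [Set.ofPred_forall]
  exact isOpen_iInter_of_finite fun i =>
    isOpen_lt (continuous_abs.comp (continuous_apply i)) continuous_const

theorem isOpen_region [L.IsLattice] (κ : Kind) {m n t : ℕ} (hmn : m < n)
    (P : Fin t → Set (L.Walk m)) (γ : Fin t → L.Walk m) : IsOpen (region κ hmn P γ) := by
  refine isOpen_iff_mem_nhds.2 fun x hx => ?_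
  obtain ⟨z, hz, hxz⟩ := exists_admissible_abs_lt hx
  refine Filter.mem_of_superset ((isOpen_setOf_abs_lt z).mem_nhds hxz) fun y hy => ?_
  exact mem_region_iff.2 ⟨z, hz, fun i => (abs_lt.1 (hy i)).1.le, fun i => (abs_lt.1 (hy i)).2.le⟩


/-! ### The generating function as a sum over walks -/

/-- The SAWs (SATs) from `o` that are counted by the coefficient `c_ν`. -/
abbrev CountedFrom [L.IsLattice] (κ : Kind) (o : L.Vertex) (ν : L.EdgeClass → ℕ) : Type :=
  {W : L.Walk (∑ i, ν i) // W.IsAvoiding κ ∧ W.start = o ∧ W.count = ν}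

instance [L.IsLattice] (κ : Kind) (o : L.Vertex) (ν : L.EdgeClass → ℕ) :
    Finite (CountedFrom κ o ν) :=
  ((Walk.finite_start _ o).subset fun _ hW => hW.2.1 :
    {W : L.Walk (∑ i, ν i) | W.IsAvoiding κ ∧ W.start = o ∧ W.count = ν}.Finite).to_subtype

/-- Sorting the SAWs (SATs) from `o` by their numbers of edges of every class. -/
noncomputable def sortByCount [L.IsLattice] (κ : Kind) (o : L.Vertex) :
    (Σ ν : L.EdgeClass → ℕ, CountedFrom κ o ν) ≃ Σ N, AvoidingFrom κ o N :=
  Equiv.ofBijective (fun p => ⟨∑ i, p.1 i, p.2.1, p.2.2.1, p.2.2.2.1⟩) <| by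
    constructor
    · rintro ⟨ν, W, hW, hs, hc⟩ ⟨ν', W', hW', hs', hc'⟩ h
      -- The index `ν` can be read off the walk as its vector of counts.
      have hν : ν = ν' := by
        have := congrArg (fun q : Σ N, AvoidingFrom κ o N => q.2.1.count) h
        exact hc.symm.trans (this.trans hc')
      subst hν
      simp only [Sigma.mk.injEq, heq_eq_eq, true_and, Subtype.mk.injEq] at h
      subst h
      rfl
    · rintro ⟨N, W, hW, hs⟩
      -- The length `∑ i, W.count i` equals `N` only propositionally; a variable `M` allows the walk
      -- to be transported.
      have key : ∀ M, M = N → ∃ W' : L.Walk M, W'.IsAvoiding κ ∧ W'.start = o ∧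
          W'.count = W.count ∧ HEq W' W := by
        rintro M rfl
        exact ⟨W, hW, hs, rfl, HEq.rfl⟩
      obtain ⟨W', h1, h2, h3, h4⟩ := key _ W.sum_count
      refine ⟨⟨W.count, W', h1, h2, h3⟩, ?_⟩
      have hN := W.sum_count
      have key' : ∀ M (V : L.Walk M) (hV : V.IsAvoiding κ ∧ V.start = o), M = N → HEq V W →
          (⟨M, V, hV⟩ : Σ N, AvoidingFrom κ o N) = ⟨N, W, hW, hs⟩ := by
        rintro M V hV rfl hVW
        obtain rfl := eq_of_heq hVW
        rfl
      exact key' _ W' _ hN h4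

/-- All walks counted by `c_ν` have the same weight `x ^ ν`. -/
theorem tsum_countedFrom [L.IsLattice] (κ : Kind) (o : L.Vertex) (x : L.EdgeClass → ℝ)
    (ν : L.EdgeClass → ℕ) : ∑' W : CountedFrom κ o ν, weight x W.1 = genTerm κ o x ν := by
  have : ∀ W : CountedFrom κ o ν, weight x W.1 = ∏ i, x i ^ ν i := fun W => by
    simp only [weight, W.2.2.2]
  simp only [this, tsum_const, nsmul_eq_mul]
  rfl

theorem abs_weight_le [L.IsLattice] {x z : L.EdgeClass → ℝ} (h : ∀ i, |x i| ≤ z i) {n : ℕ}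
    (W : L.Walk n) : ‖weight x W‖ ≤ weight z W := by
  simp only [weight, Real.norm_eq_abs, Finset.abs_prod, abs_pow]
  exact Finset.prod_le_prod (fun _ _ => by positivity) fun i _ =>
    pow_le_pow_left₀ (abs_nonneg _) (h i) _

theorem summable_weight_of_abs_le [L.IsLattice] {κ : Kind} {o : L.Vertex}
    {x z : L.EdgeClass → ℝ} (hz : Summable fun p : Σ N, AvoidingFrom κ o N => weight z p.2.1)
    (h : ∀ i, |x i| ≤ z i) : Summable fun p : Σ N, AvoidingFrom κ o N => weight x p.2.1 :=
  Summable.of_norm_bounded hz fun p => abs_weight_le h p.2.1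

/-- The coefficients are nonnegative, so the norm of a term is the term at `|x|`, which is a sum of
walk weights over one fibre of `sortByCount`. -/
theorem summable_norm_genTerm [L.IsLattice] {κ : Kind} {o : L.Vertex}
    {x z : L.EdgeClass → ℝ} (hz : Summable fun p : Σ N, AvoidingFrom κ o N => weight z p.2.1)
    (h : ∀ i, |x i| ≤ z i) : Summable fun ν => ‖genTerm κ o x ν‖ := by
  have h1 := ((sortByCount κ o).summable_iff.2
    (summable_weight_of_abs_le hz (x := fun i => |x i|) (fun i => by simpa using h i))).sigma
  refine h1.congr fun ν => ?_
  refine (tsum_countedFrom κ o (fun i => |x i|) ν).trans ?_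
  simp [genTerm]

/-- One absolutely summable family of walks is grouped by edge counts and by length; the latter
grouping has homogeneous terms, as a power series needs. -/
theorem tsum_genTerm [L.IsLattice] {κ : Kind} {o : L.Vertex}
    {x z : L.EdgeClass → ℝ} (hz : Summable fun p : Σ N, AvoidingFrom κ o N => weight z p.2.1)
    (h : ∀ i, |x i| ≤ z i) :
    ∑' ν, genTerm κ o x ν = ∑' N, ∑ W : AvoidingFrom κ o N, weight x W.1 := by
  have h1 := summable_weight_of_abs_le hz h
  have h2 := (sortByCount κ o).tsum_eq fun p : Σ N, AvoidingFrom κ o N => weight x p.2.1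
  have h3 := ((sortByCount κ o).summable_iff.2 h1).tsum_sigma
  rw [h1.tsum_sigma] at h2
  simp only [tsum_fintype] at h2
  rw [← h2]
  refine Eq.trans (tsum_congr fun ν => ?_) h3.symm
  exact (tsum_countedFrom κ o x ν).symm

/-! ### Analyticity -/

/-- The weight of a walk as a multilinear map, with one argument for every step. -/
noncomputable def weightMultilinear [L.IsLattice] {n : ℕ} (W : L.Walk n) :
    ContinuousMultilinearMap ℝ (fun _ : Fin n => L.EdgeClass → ℝ) ℝ :=
  (ContinuousMultilinearMap.mkPiAlgebra ℝ (Fin n) ℝ).compContinuousLinearMap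
    fun j => ContinuousLinearMap.proj (L.edgeClass (W.edge j))

theorem weightMultilinear_apply [L.IsLattice] {n : ℕ} (W : L.Walk n)
    (y : Fin n → L.EdgeClass → ℝ) :
    weightMultilinear W y = ∏ j, y j (L.edgeClass (W.edge j)) := by
  simp [weightMultilinear]

theorem norm_weightMultilinear_le [L.IsLattice] {n : ℕ} (W : L.Walk n) :
    ‖weightMultilinear W‖ ≤ 1 := by
  refine ContinuousMultilinearMap.opNorm_le_bound zero_le_one fun y => ?_
  rw [weightMultilinear_apply, one_mul, norm_prod]
  exact Finset.prod_le_prod (fun _ _ => norm_nonneg _) fun j _ => norm_le_pi_norm _ _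

/-- The power series of `y ↦ ∑ W, 𝐰_z(W) 𝐰_y(W)`, summed over the SAWs (SATs) from `o`. -/
noncomputable def weightSeries [L.IsLattice] (κ : Kind) (o : L.Vertex) (z : L.EdgeClass → ℝ) :
    FormalMultilinearSeries ℝ (L.EdgeClass → ℝ) ℝ := fun N =>
  ∑ W : AvoidingFrom κ o N, weight z W.1 • weightMultilinear W.1

theorem weightSeries_apply [L.IsLattice] (κ : Kind) (o : L.Vertex) (z y : L.EdgeClass → ℝ)
    (N : ℕ) : (weightSeries κ o z N fun _ => y) =
      ∑ W : AvoidingFrom κ o N, weight (z * y) W.1 := by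
  simp [weightSeries, weightMultilinear_apply, weight_mul, ← weight_eq_prod]

/-- In the sup norm each `weightMultilinear W` has norm at most `1`, so the `N`-th coefficient is
bounded by the total weight at `z` of the `N`-step walks. -/
theorem one_le_radius_weightSeries [L.IsLattice] {κ : Kind} {o : L.Vertex}
    {z : L.EdgeClass → ℝ} (hpos : ∀ i, 0 < z i)
    (hz : Summable fun p : Σ N, AvoidingFrom κ o N => weight z p.2.1) :
    1 ≤ (weightSeries κ o z).radius := by
  have h : Summable fun N => ∑ W : AvoidingFrom κ o N, weight z W.1 := by
    simpa only [tsum_fintype] using hz.sigma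
  refine FormalMultilinearSeries.le_radius_of_summable _ (r := 1)
    (Summable.of_nonneg_of_le (fun _ => by positivity) (fun N => ?_) h)
  rw [NNReal.coe_one, one_pow, mul_one]
  refine (norm_sum_le _ _).trans (Finset.sum_le_sum fun W _ => ?_)
  rw [norm_smul, Real.norm_of_nonneg (weight_pos hpos _).le]
  exact mul_le_of_le_one_right (weight_pos hpos _).le (norm_weightMultilinear_le _)

/-- Dividing coordinate `i` by `z i` maps the open box onto the open unit ball of the sup norm,
where `weightSeries` converges. The strict inequality in `h` keeps `x` off the boundary. -/
theorem analyticAt_tsum_genTerm [L.IsLattice] {κ : Kind} {o : L.Vertex}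
    {x z : L.EdgeClass → ℝ} (hz : Summable fun p : Σ N, AvoidingFrom κ o N => weight z p.2.1)
    (h : ∀ i, |x i| < z i) :
    AnalyticAt ℝ (fun x : L.EdgeClass → ℝ => ∑' ν, genTerm κ o x ν) x := by
  have hpos : ∀ i, 0 < z i := fun i => (abs_nonneg _).trans_lt (h i)
  have hrad := one_le_radius_weightSeries hpos hz
  have hseries := (weightSeries κ o z).hasFPowerSeriesOnBall (one_pos.trans_le hrad)
  let scale : (L.EdgeClass → ℝ) →L[ℝ] (L.EdgeClass → ℝ) :=
    ContinuousLinearMap.pi fun i => (z i)⁻¹ • ContinuousLinearMap.proj i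
  have hscale : ∀ y i, scale y i = (z i)⁻¹ * y i := fun y i => rfl
  have hmem : scale x ∈ Metric.eball (0 : L.EdgeClass → ℝ) (weightSeries κ o z).radius := by
    refine Metric.eball_subset_eball hrad ?_
    rw [← ENNReal.ofReal_one, Metric.eball_ofReal, mem_ball_zero_iff, pi_norm_lt_iff one_pos]
    intro i
    rw [hscale, norm_mul, norm_inv, Real.norm_of_nonneg (hpos i).le, inv_mul_lt_iff₀ (hpos i),
      mul_one]
    exact h i
  have hcomp : AnalyticAt ℝ (fun y => (weightSeries κ o z).sum (scale y)) x :=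
    (hseries.analyticOnNhd _ hmem).comp (scale.analyticAt x)
  refine hcomp.congr ?_
  filter_upwards [(isOpen_setOf_abs_lt z).mem_nhds h] with y hy
  rw [tsum_genTerm hz fun i => (hy i).le, FormalMultilinearSeries.sum]
  refine tsum_congr fun N => ?_
  rw [weightSeries_apply]
  have : z * scale y = y := funext fun i => by
    rw [Pi.mul_apply, hscale, mul_inv_cancel_left₀ (hpos i).ne']
  rw [this]

end DrawnGraph

end SAW

/-! ### The main theorem -/

theorem corollary3 {D : ℕ} (L : SAW.DrawnGraph D) [L.IsLattice]
    (κ : SAW.DrawnGraph.Kind)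
    (v : L.VertexClass → L.Vertex) (hv : ∀ k, L.vertexClass (v k) = k)
    (m n : ℕ) (hmn : m < n)
    (t : ℕ) (P : Fin t → Set (L.Walk m)) (hP : SAW.DrawnGraph.IsPartition κ v P)
    (γ : Fin t → L.Walk m) (hγ : ∀ r, γ r ∈ P r) :
    IsOpen (SAW.DrawnGraph.region κ hmn P γ) ∧
    ∀ (k : L.VertexClass) (o : L.Vertex), L.vertexClass o = k →
      (∀ x ∈ SAW.DrawnGraph.region κ hmn P γ,
        Summable fun ν : L.EdgeClass → ℕ => ‖SAW.DrawnGraph.genTerm κ o x ν‖) ∧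
      AnalyticOnNhd ℝ
        (fun x : L.EdgeClass → ℝ => ∑' ν : L.EdgeClass → ℕ, SAW.DrawnGraph.genTerm κ o x ν)
        (SAW.DrawnGraph.region κ hmn P γ) := by
  refine ⟨SAW.DrawnGraph.isOpen_region κ hmn P γ, fun _ o _ => ⟨fun x hx => ?_, fun x hx => ?_⟩⟩
  · obtain ⟨z, hz, hxz⟩ := SAW.DrawnGraph.exists_admissible_abs_lt hx
    exact SAW.DrawnGraph.summable_norm_genTerm (hz.summable_weight hv hP hγ o) fun i => (hxz i).le
  · obtain ⟨z, hz, hxz⟩ := SAW.DrawnGraph.exists_admissible_abs_lt hx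
    exact SAW.DrawnGraph.analyticAt_tsum_genTerm (hz.summable_weight hv hP hγ o) hxz
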